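/- Let $m\ge 1$ be an integer and let $n=2^m$. Let $Q_n$ be the hypercube, whose vertices are the subsets of $\{1,\dots,n\}$, two subsets $A,B$ being adjacent if and only if $|A\,\Delta\,B|=1$. Put $r=2^{\,n-1-m}$. Then $Q_n$ can be decomposed into $r$ cycles $C_1,\dots,C_r$, each of length $2^m n=n^2$ (that is, $C_1,\dots,C_r$ are subgraphs of $Q_n$, each a cycle of length $2^m n$, such that every edge of $Q_n$ lies in exactly one of them), and one can choose edges $e_{i,j}$ of $Q_n$ ($1\le i\le r$, $1\le j\le 2^m$) such that the following hold. (I) For every $i$, the edges $e_{i,1},\dots,e_{i,2^m}$ are $2^m$ distinct edges of $C_i$, and the graph obtained from $C_i$ by deleting these edges (and keeping all vertices) has exactly $2^m$ connected components, each of which is a path of length $n-1$ (that is, with $n-1$ edges). (II) The set $M=\{e_{i,j} : 1\le i\le r,\ 1\le j\le 2^m\}$ is a perfect matching of $Q_n$. -/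

import Mathlib

/-- The hypercube `Q_n`: the vertices are the subsets of an `n`-element set, and two subsets are
adjacent when their symmetric difference has exactly one element. -/
def hypercube (n : ℕ) : SimpleGraph (Finset (Fin n)) where
  Adj A B := (symmDiff A B).card = 1
  symm := ⟨fun A B h => by rwa [symmDiff_comm]⟩
  loopless := ⟨fun A h => by simp at h⟩

namespace SimpleGraph

/-- `G` is a cycle of length `k`. The requirement `3 ≤ k` excludes the degenerate values of
`cycleGraph`. -/
def IsCycleOfLength {V : Type*} (G : SimpleGraph V) (k : ℕ) : Prop :=
  3 ≤ k ∧ Nonempty (G ≃g cycleGraph k)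

/-- `G` is a path of length `l`, that is, with `l` edges and `l + 1` vertices. -/
def IsPathOfLength {V : Type*} (G : SimpleGraph V) (l : ℕ) : Prop :=
  Nonempty (G ≃g pathGraph (l + 1))

/-- The subgraphs `C i` decompose `G`: their edge sets are pairwise disjoint and together
they make up all edges of `G`. -/
def IsDecomposition {V ι : Type*} (G : SimpleGraph V) (C : ι → G.Subgraph) : Prop :=
  (∀ i j, i ≠ j → Disjoint (C i).edgeSet (C j).edgeSet) ∧ ⋃ i, (C i).edgeSet = G.edgeSet

end SimpleGraph

/-! Cycles are handled as injective maps from the integers modulo `n ^ 2`, cut into `n` blocks of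
`n` vertices; the matching edges join the end of one block (index `-1` modulo `n`) to the start of
the next (index `0`). Only coverage of edges and of vertices is demanded. With `r = 2 ^ (n - 1 - m)`
walks, `r * n ^ 2` is the number of edges and `r * 2 * n` the number of vertices, so coverage forces
uniqueness: the cycles are edge-disjoint and the chosen edges form a perfect matching
(`edge_unique`, `vertex_unique`).

The existence proof doubles `n`, since the cube of dimension `2 * n` is the square of the cube of
dimension `n`. In the product of walks `c i` (columns) and `c j` (rows), a zigzag walk has blocks of
`2 * n` steps: horizontally from column `n * T` to `n * T + a`, vertically by `n` up or down, then
horizontally to column `n * (T + 1)`. Here `a` is `0` or `n - 1`; horizontal steps use only rows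
congruent to `a` and vertical steps only columns congruent to `a`. As the indices congruent to `0`
or `-1` meet every vertex of a factor, both values of `a` together reach every row and every column.

The heights `E T` change by `1` per block and gain `h = n / 2` over `n` blocks, so the `h` shifts
`d` reach every height. One circuit of the columns lifts the row by half its period; the walk closes
after two circuits, with length `(2 * n) ^ 2`. By parity such an `E` needs `4 ∣ n`, so dimensions 2
and 4 are settled by explicit cycles. -/

/-- A family `c` of closed walks of length `n ^ 2` in `G`, each of them a cycle, which cover all
edges of `G` and such that the edges from `c i (n * t - 1)` to `c i (n * t)` cover all vertices. -/
structure IsMatchedCycleSystem {V ι : Type*} (G : SimpleGraph V) (n : ℕ) (c : ι → ℤ → V) :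
    Prop where
  eq_iff : ∀ i x y, c i x = c i y ↔ (n : ℤ) ^ 2 ∣ x - y
  adj : ∀ i x, G.Adj (c i x) (c i (x + 1))
  edge : ∀ u v, G.Adj u v → ∃ i x, s(u, v) = s(c i x, c i (x + 1))
  vertex : ∀ v, ∃ i t, v = c i (n * t) ∨ v = c i (n * t + (n - 1))

theorem IsMatchedCycleSystem.map {V W ι κ : Type*} {G : SimpleGraph V} {H : SimpleGraph W} {n : ℕ}
    {c : ι → ℤ → V} (hc : IsMatchedCycleSystem G n c) (f : G ≃g H) (g : κ ≃ ι) :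
    IsMatchedCycleSystem H n (fun i x => f (c (g i) x)) where
  eq_iff i x y := by rw [f.injective.eq_iff, hc.eq_iff]
  adj i x := f.map_adj_iff.2 (hc.adj _ _)
  edge u v h := by
    obtain ⟨i, x, hx⟩ := hc.edge _ _ (f.symm.map_adj_iff.2 h)
    refine ⟨g.symm i, x, ?_⟩
    have := congrArg (Sym2.map f) hx
    simpa using this
  vertex v := by
    obtain ⟨i, t, h⟩ := hc.vertex (f.symm v)
    refine ⟨g.symm i, t, h.imp (fun h => ?_) (fun h => ?_)⟩ <;> simp [← h]

/-! ### Zigzag walks in a product -/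

/-- A sequence of integers with steps `1` and `-1` that gains `2 * k` in `4 * k` steps. -/
theorem exists_unit_steps_half_drift (k : ℕ) (hk : 1 ≤ k) :
    ∃ E : ℤ → ℤ, (∀ T, E (T + 4 * k) = E T + 2 * k) ∧
      ∀ T, E (T + 1) = E T + 1 ∨ E (T + 1) = E T - 1 := by
  -- Each period climbs `3 * k` steps and then descends `k`.
  refine ⟨fun T => 2 * k * (T / (4 * k)) + min (T % (4 * k)) (6 * k - T % (4 * k)), ?_, ?_⟩
  · intro T
    have h0 : (4 * k : ℤ) ≠ 0 := by omega
    have h1 : (T + 4 * k) / (4 * k) = T / (4 * k) + 1 := by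
      simpa using Int.add_mul_ediv_right T 1 h0
    simp only [h1, Int.add_emod_right]
    ring
  · intro T
    have h0 : (0 : ℤ) < 4 * k := by omega
    have hq := Int.mul_ediv_add_emod T (4 * k)
    have hr0 := Int.emod_nonneg T h0.ne'
    have hr1 := Int.emod_lt_of_pos T h0
    dsimp only
    generalize hQ : T / (4 * k) = Q at *
    generalize hR : T % (4 * k) = R at *
    by_cases hlast : R + 1 = 4 * k
    · have h1 : T + 1 = 0 + (Q + 1) * (4 * k) := by linear_combination hlast - hq
      have hd : (T + 1) / (4 * k) = Q + 1 := by
        rw [h1, Int.add_mul_ediv_right _ _ h0.ne']; simp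
      have hm : (T + 1) % (4 * k) = 0 := by rw [h1, Int.add_mul_emod_self_right]; simp
      simp only [hd, hm, mul_add, mul_one]
      omega
    · have h1 : T + 1 = (R + 1) + Q * (4 * k) := by linear_combination - hq
      have hd : (T + 1) / (4 * k) = Q := by
        rw [h1, Int.add_mul_ediv_right _ _ h0.ne',
          Int.ediv_eq_zero_of_lt (by omega) (by omega)]; simp
      have hm : (T + 1) % (4 * k) = R + 1 := by
        rw [h1, Int.add_mul_emod_self_right, Int.emod_eq_of_lt (by omega) (by omega)]
      simp only [hd, hm]
      omega

/-- Column of a zigzag walk, `S` steps into its block `T`: the walk makes `a` horizontal, `n`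
vertical and `n - a` horizontal steps. -/
def zigzagCol (n a T S : ℤ) : ℤ := n * T + min S a + max 0 (S - (a + n))

/-- Row of a zigzag walk, `S` steps into its block `T`, where `E T` is the block height. -/
def zigzagRow (n a d : ℤ) (E : ℤ → ℤ) (T S : ℤ) : ℤ :=
  n * (d + E T) + a + (E (T + 1) - E T) * max 0 (min (S - a) n)

theorem zigzagCol_two_mul {n a T : ℤ} (ha : 0 ≤ a) (han : a < n) :
    zigzagCol n a T (2 * n) = zigzagCol n a (T + 1) 0 := by
  simp only [zigzagCol, mul_add]; omega

theorem zigzagRow_two_mul {n a d T : ℤ} {E : ℤ → ℤ} (ha : 0 ≤ a) (han : a < n) :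
    zigzagRow n a d E T (2 * n) = zigzagRow n a d E (T + 1) 0 := by
  have h1 : max 0 (min (2 * n - a) n) = n := by omega
  have h2 : max 0 (min (0 - a) n) = 0 := by omega
  rw [zigzagRow, zigzagRow, h1, h2]; ring

/-- Residues modulo `n` of the positions of the endpoints of the matching edges. -/
def side (n : ℕ) (b : Bool) : ℤ := if b then n - 1 else 0

theorem side_nonneg {n : ℕ} (hn : 0 < n) (b : Bool) : 0 ≤ side n b := by
  unfold side; split <;> omega

theorem side_lt {n : ℕ} (hn : 0 < n) (b : Bool) : side n b < n := by
  unfold side; split <;> omega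

/-- The zigzag walk in the product of two families of walks. -/
def zigzag {V ι : Type*} (n : ℕ) (E : ℤ → ℤ) (c : ι → ℤ → V) {h : ℕ}
    (i : ι × ι × Bool × Fin h) (p : ℤ) : V × V :=
  (c i.1 (zigzagCol n (side n i.2.2.1) (p / (2 * n)) (p % (2 * n))),
    c i.2.1 (zigzagRow n (side n i.2.2.1) i.2.2.2 E (p / (2 * n)) (p % (2 * n))))

section

variable {V ι : Type*} {n h : ℕ} {E : ℤ → ℤ} {c : ι → ℤ → V}

/-- The offset `S = 2 * n` is allowed so that a step across a block boundary needs no separate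
treatment. -/
theorem zigzag_mul_add (hn : 0 < n) (i j : ι) (b : Bool) (d : Fin h) (T S : ℤ)
    (hS : 0 ≤ S) (hS' : S ≤ 2 * n) :
    zigzag n E c (i, j, b, d) (2 * n * T + S) =
      (c i (zigzagCol n (side n b) T S),
        c j (zigzagRow n (side n b) d E T S)) := by
  have h0 : (2 * n : ℤ) ≠ 0 := by omega
  have ha : (0 : ℤ) ≤ side n b := side_nonneg hn b
  have han : side n b < n := side_lt hn b
  rcases hS'.lt_or_eq with hlt | rfl
  · have hd : (2 * n * T + S) / (2 * n) = T := by
      rw [add_comm, Int.add_mul_ediv_left _ _ h0, Int.ediv_eq_zero_of_lt hS hlt, zero_add]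
    have hm : (2 * n * T + S) % (2 * n) = S := by
      rw [add_comm, Int.add_mul_emod_self_left, Int.emod_eq_of_lt hS hlt]
    simp only [zigzag, hd, hm]
  · have e : 2 * n * T + 2 * n = (2 * n * (T + 1) : ℤ) := by ring
    rw [e, zigzagCol_two_mul ha han, zigzagRow_two_mul ha han]
    simp only [zigzag, Int.mul_ediv_cancel_left _ h0, Int.mul_emod_right]

/-- Write `p` as block number and offset. -/
theorem exists_block_offset (hn : 0 < n) (p : ℤ) :
    ∃ T S : ℤ, p = 2 * n * T + S ∧ 0 ≤ S ∧ S < 2 * n :=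
  ⟨p / (2 * n), p % (2 * n), (Int.mul_ediv_add_emod _ _).symm, Int.emod_nonneg _ (by omega),
    Int.emod_lt_of_pos _ (by omega)⟩

theorem drift_mul (hE : ∀ T, E (T + n) = E T + h) (T q : ℤ) : E (T + n * q) = E T + h * q := by
  induction q using Int.induction_on with
  | zero => simp
  | succ q ih => rw [mul_add, mul_one, ← add_assoc, hE, ih]; ring
  | pred q ih =>
    have := hE (T + n * (-q - 1))
    rw [show T + n * (-q - 1) + n = T + n * (-q : ℤ) by ring, ih] at this
    linear_combination -this

/-- Any height is attained in a block of a given class by one of the walks. -/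
theorem exists_height (hh : 0 < h) (hE : ∀ T, E (T + n) = E T + h) (T t : ℤ) :
    ∃ (d : Fin h) (q : ℤ), (d : ℤ) + E (T + n * q) = t := by
  have h0 := Int.emod_nonneg (t - E T) (b := h) (by omega)
  have h1 := Int.emod_lt_of_pos (t - E T) (b := h) (by omega)
  refine ⟨⟨((t - E T) % h).toNat, by omega⟩, (t - E T) / h, ?_⟩
  rw [drift_mul hE]
  have := Int.mul_ediv_add_emod (t - E T) h
  simp only [Int.toNat_of_nonneg h0]
  linear_combination this

theorem zigzag_adj {G : SimpleGraph V} (hc : IsMatchedCycleSystem G n c) (hn : 0 < n)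
    (hE : ∀ T, E (T + 1) = E T + 1 ∨ E (T + 1) = E T - 1) (i : ι × ι × Bool × Fin h) (p : ℤ) :
    (G □ G).Adj (zigzag n E c i p) (zigzag n E c i (p + 1)) := by
  obtain ⟨T, S, rfl, hS0, hS1⟩ := exists_block_offset hn p
  obtain ⟨i, j, b, d⟩ := i
  rw [add_assoc, zigzag_mul_add hn _ _ _ _ _ _ hS0 hS1.le,
    zigzag_mul_add hn _ _ _ _ _ _ (by omega) (by omega)]
  have ha : (0 : ℤ) ≤ side n b := side_nonneg hn b
  have han : side n b < n := side_lt hn b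
  generalize side n b = a at *
  rw [SimpleGraph.boxProd_adj]
  by_cases hv : a ≤ S ∧ S < a + n
  · right
    have e1 : zigzagCol n a T (S + 1) = zigzagCol n a T S := by simp only [zigzagCol]; omega
    have e2 : max 0 (min (S + 1 - a) (n : ℤ)) = max 0 (min (S - a) n) + 1 := by omega
    refine ⟨?_, by rw [e1]⟩
    rcases hE T with h | h
    · have : zigzagRow n a d E T (S + 1) = zigzagRow n a d E T S + 1 := by
        rw [zigzagRow, zigzagRow, e2, h]; ring
      rw [this]; exact hc.adj _ _
    · have : zigzagRow n a d E T S = zigzagRow n a d E T (S + 1) + 1 := by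
        rw [zigzagRow, zigzagRow, e2, h]; ring
      rw [this]; exact (hc.adj _ _).symm
  · left
    have e1 : zigzagCol n a T (S + 1) = zigzagCol n a T S + 1 := by simp only [zigzagCol]; omega
    have e2 : max 0 (min (S + 1 - a) (n : ℤ)) = max 0 (min (S - a) n) := by omega
    refine ⟨?_, by simp only [zigzagRow, e2]⟩
    rw [e1]; exact hc.adj _ _

theorem IsMatchedCycleSystem.eq_of_sub_eq {G : SimpleGraph V} (hc : IsMatchedCycleSystem G n c)
    {i : ι} {x y : ℤ} (q : ℤ) (h : x = y + n ^ 2 * q) : c i x = c i y :=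
  (hc.eq_iff i x y).2 ⟨q, by rw [h]; ring⟩

/-- The rows (or columns) in use are exactly those through endpoints of the matching. -/
theorem IsMatchedCycleSystem.exists_side {G : SimpleGraph V} (hc : IsMatchedCycleSystem G n c)
    (v : V) : ∃ i t, ∃ b : Bool, v = c i (n * t + side n b) := by
  obtain ⟨i, t, h | h⟩ := hc.vertex v
  · exact ⟨i, t, false, by simpa [side] using h⟩
  · exact ⟨i, t, true, by simpa [side] using h⟩

/-- The fixed vertex of a product edge determines `b`: through its row for a horizontal edge,
through its column for a vertical one. The edge then lies in a known part of a block at a known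
height, and `exists_height` supplies a walk attaining it. -/
theorem zigzag_edge {G : SimpleGraph V} (hc : IsMatchedCycleSystem G n c) (hn : 0 < n) (hh : 0 < h)
    (hE : ∀ T, E (T + n) = E T + h) (hE1 : ∀ T, E (T + 1) = E T + 1 ∨ E (T + 1) = E T - 1)
    (u v : V × V) (huv : (G □ G).Adj u v) :
    ∃ (i : ι × ι × Bool × Fin h) (p : ℤ),
      s(u, v) = s(zigzag n E c i p, zigzag n E c i (p + 1)) := by
  obtain ⟨u1, u2⟩ := u
  obtain ⟨v1, v2⟩ := v
  rw [SimpleGraph.boxProd_adj] at huv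
  rcases huv with ⟨huv, rfl : u2 = v2⟩ | ⟨huv, rfl : u1 = v1⟩
  · obtain ⟨i, x, hx⟩ := hc.edge _ _ huv
    obtain ⟨j, t, b, ht⟩ := hc.exists_side u2
    have ha : (0 : ℤ) ≤ side n b := side_nonneg hn b
    have han : side n b < n := side_lt hn b
    suffices H : ∃ (d : Fin h) (p : ℤ), zigzag n E c (i, j, b, d) p = (c i x, u2) ∧
        zigzag n E c (i, j, b, d) (p + 1) = (c i (x + 1), u2) by
      obtain ⟨d, p, h1, h2⟩ := H
      refine ⟨(i, j, b, d), p, ?_⟩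
      rw [h1, h2]
      exact congrArg (Sym2.map (fun w => (w, u2))) hx
    have hx' := Int.mul_ediv_add_emod x n
    have hs0 := Int.emod_nonneg x (b := n) (by omega)
    have hs1 := Int.emod_lt_of_pos x (b := n) (by omega)
    generalize x / n = T at *
    generalize x % n = s at *
    -- Horizontal steps before the vertical run have height `E T`, those after it height `E (T +
    -- 1)`.
    by_cases hs : s < side n b
    · obtain ⟨d, q, hd⟩ := exists_height hh hE T t
      refine ⟨d, 2 * n * (T + n * q) + s, ?_, ?_⟩
      · rw [zigzag_mul_add hn _ _ _ _ _ _ (by omega) (by omega), ht]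
        generalize side n b = a at *
        refine Prod.ext (hc.eq_of_sub_eq q ?_) (hc.eq_of_sub_eq 0 ?_)
        · have e1 : min s a = s := by omega
          have e2 : max 0 (s - (a + n)) = 0 := by omega
          rw [zigzagCol, e1, e2]; linear_combination hx'
        · have e1 : max 0 (min (s - a) (n : ℤ)) = 0 := by omega
          rw [zigzagRow, hd, e1]; ring
      · rw [add_assoc, zigzag_mul_add hn _ _ _ _ _ _ (by omega) (by omega), ht]
        generalize side n b = a at *
        refine Prod.ext (hc.eq_of_sub_eq q ?_) (hc.eq_of_sub_eq 0 ?_)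
        · have e1 : min (s + 1) a = s + 1 := by omega
          have e2 : max 0 (s + 1 - (a + n)) = 0 := by omega
          rw [zigzagCol, e1, e2]; linear_combination hx'
        · have e1 : max 0 (min (s + 1 - a) (n : ℤ)) = 0 := by omega
          rw [zigzagRow, hd, e1]; ring
    · obtain ⟨d, q, hd⟩ := exists_height hh hE (T + 1) t
      rw [add_right_comm] at hd
      refine ⟨d, 2 * n * (T + n * q) + (s + n), ?_, ?_⟩
      · rw [zigzag_mul_add hn _ _ _ _ _ _ (by omega) (by omega), ht]
        generalize side n b = a at *
        refine Prod.ext (hc.eq_of_sub_eq q ?_) (hc.eq_of_sub_eq 0 ?_)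
        · have e1 : min (s + n) a = a := by omega
          have e2 : max 0 (s + n - (a + n)) = s - a := by omega
          rw [zigzagCol, e1, e2]; linear_combination hx'
        · have e1 : max 0 (min (s + n - a) (n : ℤ)) = n := by omega
          rw [zigzagRow, e1]; linear_combination n * hd
      · rw [add_assoc, zigzag_mul_add hn _ _ _ _ _ _ (by omega) (by omega), ht]
        generalize side n b = a at *
        refine Prod.ext (hc.eq_of_sub_eq q ?_) (hc.eq_of_sub_eq 0 ?_)
        · have e1 : min (s + n + 1) a = a := by omega
          have e2 : max 0 (s + n + 1 - (a + n)) = s + 1 - a := by omega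
          rw [zigzagCol, e1, e2]; linear_combination hx'
        · have e1 : max 0 (min (s + n + 1 - a) (n : ℤ)) = n := by omega
          rw [zigzagRow, e1]; linear_combination n * hd
  · obtain ⟨j, y, hy⟩ := hc.edge _ _ huv
    obtain ⟨i, t, b, ht⟩ := hc.exists_side u1
    have ha : (0 : ℤ) ≤ side n b := side_nonneg hn b
    have han : side n b < n := side_lt hn b
    suffices H : ∃ (d : Fin h) (p : ℤ), (zigzag n E c (i, j, b, d) p = (u1, c j y) ∧
        zigzag n E c (i, j, b, d) (p + 1) = (u1, c j (y + 1))) ∨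
        (zigzag n E c (i, j, b, d) p = (u1, c j (y + 1)) ∧
        zigzag n E c (i, j, b, d) (p + 1) = (u1, c j y)) by
      obtain ⟨d, p, H⟩ := H
      refine ⟨(i, j, b, d), p, (congrArg (Sym2.map (fun w => (u1, w))) hy).trans ?_⟩
      rcases H with ⟨h1, h2⟩ | ⟨h1, h2⟩
      · rw [h1, h2]; rfl
      · rw [h1, h2]; exact Sym2.eq_swap
    have hcol : ∀ q S : ℤ, side n b ≤ S →
        S ≤ side n b + n →
        c i (zigzagCol n (side n b) (t + n * q) S) = u1 := by
      intro q S h1 h2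
      rw [ht]
      generalize side n b = a at *
      refine hc.eq_of_sub_eq q ?_
      have e1 : min S a = a := by omega
      have e2 : max 0 (S - (a + n)) = 0 := by omega
      rw [zigzagCol, e1, e2]; ring
    have hrow : ∀ (T S : ℤ), side n b ≤ S →
        S ≤ side n b + n → ∀ d : ℤ,
        zigzagRow n (side n b) d E T S =
        n * (d + E T) + side n b +
          (E (T + 1) - E T) * (S - side n b) := by
      intro T S h1 h2 d
      generalize side n b = a at *
      have e1 : max 0 (min (S - a) (n : ℤ)) = S - a := by omega
      rw [zigzagRow, e1]
    have hper : ∀ q, E (t + n * q + 1) - E (t + n * q) = E (t + 1) - E t := by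
      intro q
      rw [add_right_comm, drift_mul hE, drift_mul hE]; ring
    set a : ℤ := side n b with haa
    have hy' := Int.mul_ediv_add_emod (y - a) n
    have hs0 := Int.emod_nonneg (y - a) (b := n) (by omega)
    have hs1 := Int.emod_lt_of_pos (y - a) (b := n) (by omega)
    generalize (y - a) / n = t' at *
    generalize (y - a) % n = s at *
    -- The intervals from `n * t' + a` to `n * (t' + 1) + a` tile the rows; each is run upwards from
    -- height `t'` or downwards from height `t' + 1`.
    rcases hE1 t with h1 | h1
    · obtain ⟨d, q, hd⟩ := exists_height hh hE t t'
      refine ⟨d, 2 * n * (t + n * q) + (a + s), Or.inl ⟨?_, ?_⟩⟩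
      · rw [zigzag_mul_add hn _ _ _ _ _ _ (by omega) (by omega), ← haa,
          hcol _ _ (by omega) (by omega), hrow _ _ (by omega) (by omega), hper, h1, hd,
          show n * t' + a + (E t + 1 - E t) * (a + s - a) = y by linear_combination hy']
      · rw [add_assoc, zigzag_mul_add hn _ _ _ _ _ _ (by omega) (by omega), ← haa,
          hcol _ _ (by omega) (by omega), hrow _ _ (by omega) (by omega), hper, h1, hd,
          show n * t' + a + (E t + 1 - E t) * (a + s + 1 - a) = y + 1 by linear_combination hy']
    · obtain ⟨d, q, hd⟩ := exists_height hh hE t (t' + 1)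
      refine ⟨d, 2 * n * (t + n * q) + (a + (n - 1 - s)), Or.inr ⟨?_, ?_⟩⟩
      · rw [zigzag_mul_add hn _ _ _ _ _ _ (by omega) (by omega), ← haa,
          hcol _ _ (by omega) (by omega), hrow _ _ (by omega) (by omega), hper, h1, hd,
          show n * (t' + 1) + a + (E t - 1 - E t) * (a + (n - 1 - s) - a) = y + 1 by
            linear_combination hy']
      · rw [add_assoc, zigzag_mul_add hn _ _ _ _ _ _ (by omega) (by omega), ← haa,
          hcol _ _ (by omega) (by omega), hrow _ _ (by omega) (by omega), hper, h1, hd,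
          show n * (t' + 1) + a + (E t - 1 - E t) * (a + (n - 1 - s) + 1 - a) = y by
            linear_combination hy']

/-- Since `a < n`, each block ends with a horizontal step, which projects to a matching edge of the
first factor. The new matching is thus the old one times all vertices of the second factor. -/
theorem zigzag_vertex {G : SimpleGraph V} (hc : IsMatchedCycleSystem G n c) (hn : 0 < n)
    (hh : 0 < h) (hE : ∀ T, E (T + n) = E T + h) (v : V × V) :
    ∃ (i : ι × ι × Bool × Fin h) (t : ℤ), v = zigzag n E c i ((2 * n : ℕ) * t) ∨
      v = zigzag n E c i ((2 * n : ℕ) * t + ((2 * n : ℕ) - 1)) := by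
  obtain ⟨u, v⟩ := v
  obtain ⟨i, T, hT⟩ := hc.vertex u
  obtain ⟨j, t, b, ht⟩ := hc.exists_side v
  have ha : (0 : ℤ) ≤ side n b := side_nonneg hn b
  have han : side n b < n := side_lt hn b
  push_cast
  rcases hT with rfl | rfl
  · obtain ⟨d, q, hd⟩ := exists_height hh hE T t
    refine ⟨(i, j, b, d), T + n * q, Or.inl ?_⟩
    rw [← add_zero (2 * n * (T + n * q) : ℤ),
      zigzag_mul_add hn _ _ _ _ _ _ le_rfl (by omega), ht]
    generalize side n b = a at *
    refine Prod.ext (hc.eq_of_sub_eq q ?_).symm (hc.eq_of_sub_eq 0 ?_)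
    · have e1 : min 0 a = 0 := by omega
      have e2 : max 0 (0 - (a + n)) = 0 := by omega
      rw [zigzagCol, e1, e2]; ring
    · have e1 : max 0 (min (0 - a) (n : ℤ)) = 0 := by omega
      rw [zigzagRow, hd, e1]; ring
  · obtain ⟨d, q, hd⟩ := exists_height hh hE (T + 1) t
    rw [add_right_comm] at hd
    refine ⟨(i, j, b, d), T + n * q, Or.inr ?_⟩
    rw [zigzag_mul_add hn _ _ _ _ _ _ (by omega) (by omega), ht]
    generalize side n b = a at *
    refine Prod.ext (hc.eq_of_sub_eq q ?_).symm (hc.eq_of_sub_eq 0 ?_)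
    · have e1 : min (2 * n - 1 : ℤ) a = a := by omega
      have e2 : max 0 (2 * n - 1 - (a + n) : ℤ) = n - 1 - a := by omega
      rw [zigzagCol, e1, e2]; ring
    · have e1 : max 0 (min (2 * n - 1 - a) (n : ℤ)) = n := by omega
      rw [zigzagRow, e1]; linear_combination -n * hd

theorem eq_zero_of_mul_bounds {N z : ℤ} (h1 : -N < N * z) (h2 : N * z < N) : z = 0 := by
  by_contra hz
  rcases lt_or_gt_of_ne hz with h | h <;> nlinarith

/-- The column determines `T` modulo `n` and the horizontal offset; the row then determines the
vertical offset and the parity of the number of circuits. -/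
theorem zigzag_eq_iff {G : SimpleGraph V} (hc : IsMatchedCycleSystem G n c) (hh : 2 ≤ h)
    (hnh : n = 2 * h) (hE : ∀ T, E (T + n) = E T + h)
    (hE1 : ∀ T, E (T + 1) = E T + 1 ∨ E (T + 1) = E T - 1)
    (i : ι × ι × Bool × Fin h) (x y : ℤ) :
    zigzag n E c i x = zigzag n E c i y ↔ ((2 * n : ℕ) : ℤ) ^ 2 ∣ x - y := by
  have hn : 0 < n := by omega
  obtain ⟨T, S, rfl, hS0, hS1⟩ := exists_block_offset hn x
  obtain ⟨T', S', rfl, hS0', hS1'⟩ := exists_block_offset hn y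
  obtain ⟨i, j, b, d⟩ := i
  rw [zigzag_mul_add hn _ _ _ _ _ _ hS0 hS1.le, zigzag_mul_add hn _ _ _ _ _ _ hS0' hS1'.le,
    Prod.mk.injEq, hc.eq_iff, hc.eq_iff]
  have ha : 0 ≤ side n b := side_nonneg hn b
  have han : side n b < n := side_lt hn b
  generalize side n b = a at *
  generalize ((d : ℕ) : ℤ) = d at *
  push_cast
  have hnh' : (n : ℤ) = 2 * h := by omega
  have hnn : (n : ℤ) < n * h := by nlinarith
  constructor
  · rintro ⟨⟨q, hq⟩, ⟨r, hr⟩⟩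
    have h1 : (min S a + max 0 (S - (a + n))) - (min S' a + max 0 (S' - (a + n))) =
        n * (n * q - (T - T')) := by
      simp only [zigzagCol] at hq; linear_combination hq
    have hA : min S a + max 0 (S - (a + n)) < n ∧ 0 ≤ min S a + max 0 (S - (a + n)) := by omega
    have hB : min S' a + max 0 (S' - (a + n)) < n ∧ 0 ≤ min S' a + max 0 (S' - (a + n)) := by
      omega
    have h2 : n * q - (T - T') = 0 :=
      eq_zero_of_mul_bounds (N := n) (by rw [← h1]; omega) (by rw [← h1]; omega)
    rw [h2, mul_zero] at h1
    obtain rfl : T = T' + n * q := by linarith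
    rw [zigzagRow, zigzagRow, add_right_comm T', drift_mul hE, drift_mul hE] at hr
    have h3 : (E (T' + 1) - E T') *
        (max 0 (min (S - a) n) - max 0 (min (S' - a) n)) = n * h * (2 * r - q) := by
      linear_combination hr + n * r * hnh'
    -- In `h3` the left side is at most `n` in absolute value, and `n < n * h` because `2 ≤ h`.
    have h4 : 2 * r - q = 0 ∧ max 0 (min (S - a) n) - max 0 (min (S' - a) n) = 0 := by
      have h5 : 2 * r - q = 0 := by
        apply eq_zero_of_mul_bounds (N := n * h) <;> rw [← h3] <;>
          rcases hE1 T' with h | h <;> rw [h] <;> ring_nf <;> omega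
      rw [h5, mul_zero, mul_eq_zero] at h3
      refine ⟨h5, h3.resolve_left ?_⟩
      rcases hE1 T' with h | h <;> omega
    -- The horizontal and vertical offsets add up to `S`.
    obtain rfl : S = S' := by omega
    exact ⟨r, by linear_combination -2 * n ^ 2 * h4.1⟩
  · rintro ⟨q, hq⟩
    have h1 : 2 * n * (2 * n * q - (T - T')) = S - S' := by linear_combination -hq
    have h2 : 2 * n * q - (T - T') = 0 :=
      eq_zero_of_mul_bounds (N := 2 * n) (by rw [h1]; omega) (by rw [h1]; omega)
    rw [h2, mul_zero] at h1
    obtain rfl : S = S' := by omega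
    obtain rfl : T = T' + n * (2 * q) := by linarith
    refine ⟨⟨2 * q, by rw [zigzagCol, zigzagCol]; ring⟩, ⟨q, ?_⟩⟩
    rw [zigzagRow, zigzagRow, add_right_comm T', drift_mul hE, drift_mul hE]
    linear_combination -n * q * hnh'

/-- From a matched cycle system with parameter `n` in `G`, one with parameter `2 * n` in
`G □ G`. -/
theorem IsMatchedCycleSystem.boxProd {G : SimpleGraph V} {k : ℕ} (hk : 1 ≤ k)
    (hc : IsMatchedCycleSystem G (4 * k) c) :
    ∃ c' : ι × ι × Bool × Fin (2 * k) → ℤ → V × V,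
      IsMatchedCycleSystem (G □ G) (2 * (4 * k)) c' := by
  obtain ⟨E, hE, hE1⟩ := exists_unit_steps_half_drift k hk
  have hE' : ∀ T, E (T + (4 * k : ℕ)) = E T + (2 * k : ℕ) := by simpa using hE
  exact ⟨zigzag (4 * k) E c,
    { eq_iff := zigzag_eq_iff hc (by omega) (by omega) hE' hE1
      adj := zigzag_adj hc (by omega) hE1
      edge := zigzag_edge hc (by omega) (by omega) hE' hE1
      vertex := zigzag_vertex hc (by omega) (by omega) hE' }⟩

end

/-! ### Base cases and doubling for hypercubes -/

/-- Indexing by residues makes every condition finite, so explicit cycles can be checked by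
evaluation. -/
theorem IsMatchedCycleSystem.of_zmod {V ι : Type*} {G : SimpleGraph V} {n : ℕ}
    {w : ι → ZMod (n ^ 2) → V} (hinj : ∀ i, Function.Injective (w i))
    (hadj : ∀ i x, G.Adj (w i x) (w i (x + 1)))
    (hedge : ∀ u v, G.Adj u v → ∃ i x,
      (u = w i x ∧ v = w i (x + 1)) ∨ (u = w i (x + 1) ∧ v = w i x))
    (hvertex : ∀ v, ∃ i t, v = w i (n * t) ∨ v = w i (n * t + (n - 1))) :
    IsMatchedCycleSystem G n (fun i (x : ℤ) => w i x) where
  eq_iff i x y := by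
    rw [(hinj i).eq_iff, eq_comm, ZMod.intCast_eq_intCast_iff_dvd_sub]
    push_cast; rfl
  adj i x := by push_cast; exact hadj i x
  edge u v h := by
    obtain ⟨i, x, h⟩ := hedge u v h
    obtain ⟨x, rfl⟩ := ZMod.intCast_surjective x
    refine ⟨i, x, ?_⟩
    rw [Sym2.eq_iff]
    push_cast
    exact h
  vertex v := by
    obtain ⟨i, t, h⟩ := hvertex v
    obtain ⟨t, rfl⟩ := ZMod.intCast_surjective t
    refine ⟨i, t, ?_⟩
    push_cast
    exact h

/-- The hypercube of dimension `k + l` is a product of hypercubes. -/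
def hypercubeAddIso (k l : ℕ) : (hypercube k).boxProd (hypercube l) ≃g hypercube (k + l) where
  toEquiv := Finset.sumEquiv.symm.toEquiv.trans (finSumFinEquiv (m := k) (n := l)).finsetCongr
  map_rel_iff' := by
    rintro ⟨A, B⟩ ⟨A', B'⟩
    have h1 : symmDiff (A.disjSum B) (A'.disjSum B') =
        (symmDiff A A').disjSum (symmDiff B B') := by
      ext x; rcases x with x | x <;> simp [Finset.mem_symmDiff]
    have h2 : (symmDiff ((A.disjSum B).map (finSumFinEquiv (m := k) (n := l)).toEmbedding)
        ((A'.disjSum B').map finSumFinEquiv.toEmbedding)).card =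
        (symmDiff A A').card + (symmDiff B B').card := by
      rw [← Finset.card_disjSum, ← h1, ← Finset.card_map finSumFinEquiv.toEmbedding]
      congr 1
      ext x
      simp [Finset.mem_symmDiff]
    simp only [SimpleGraph.boxProd_adj, hypercube, Equiv.trans_apply, Equiv.finsetCongr_apply]
    change (symmDiff ((A.disjSum B).map (finSumFinEquiv (m := k) (n := l)).toEmbedding)
        ((A'.disjSum B').map finSumFinEquiv.toEmbedding)).card = 1 ↔ _
    rw [h2]
    have h3 : A = A' ↔ (symmDiff A A').card = 0 := by
      rw [Finset.card_eq_zero]; exact symmDiff_eq_bot.symm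
    have h4 : B = B' ↔ (symmDiff B B').card = 0 := by
      rw [Finset.card_eq_zero]; exact symmDiff_eq_bot.symm
    rw [h3, h4]
    omega

/-- The subset of `Fin n` whose indicator function is given by the binary digits of `x`. -/
def bitSet (n x : ℕ) : Finset (Fin n) := Finset.univ.filter fun j => x.testBit j

theorem exists_matchedCycleSystem_hypercube_two :
    ∃ c : Fin 1 → ℤ → Finset (Fin 2), IsMatchedCycleSystem (hypercube 2) 2 c := by
  let w : Fin 1 → ZMod (2 ^ 2) → Finset (Fin 2) := fun _ x =>
    bitSet 2 (![0, 1, 3, 2] (show Fin 4 from x))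
  refine ⟨_, IsMatchedCycleSystem.of_zmod (w := w) ?_ ?_ ?_ ?_⟩
  · change ∀ i, ∀ x y : ZMod 4, w i x = w i y → x = y
    decide +kernel
  · change ∀ i, ∀ x : ZMod 4, (symmDiff (w i x) (w i (x + 1))).card = 1
    decide +kernel
  · change ∀ u v : Finset (Fin 2), (symmDiff u v).card = 1 → ∃ i, ∃ x : ZMod 4, _
    decide +kernel
  · change ∀ v : Finset (Fin 2), ∃ i, ∃ x : ZMod 4, _
    decide +kernel

theorem exists_matchedCycleSystem_hypercube_four :
    ∃ c : Fin 2 → ℤ → Finset (Fin 4), IsMatchedCycleSystem (hypercube 4) 4 c := by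
  -- The entries at positions `0` and `3` modulo `4` of the two lists exhaust `0, ..., 15`.
  let w : Fin 2 → ZMod (4 ^ 2) → Finset (Fin 4) := fun i x => bitSet 4
    (![![1, 3, 2, 6, 7, 5, 13, 9, 8, 10, 11, 15, 14, 12, 4, 0],
      ![10, 14, 6, 4, 5, 1, 9, 11, 3, 7, 15, 13, 12, 8, 0, 2]] i (show Fin 16 from x))
  refine ⟨_, IsMatchedCycleSystem.of_zmod (w := w) ?_ ?_ ?_ ?_⟩
  · change ∀ i, ∀ x y : ZMod 16, w i x = w i y → x = y
    decide +kernel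
  · change ∀ i, ∀ x : ZMod 16, (symmDiff (w i x) (w i (x + 1))).card = 1
    decide +kernel
  · change ∀ u v : Finset (Fin 4), (symmDiff u v).card = 1 → ∃ i, ∃ x : ZMod 16, _
    decide +kernel
  · change ∀ v : Finset (Fin 4), ∃ i, ∃ x : ZMod 16, _
    decide +kernel

theorem IsMatchedCycleSystem.hypercube_double {k r N r' : ℕ} (hk : 1 ≤ k)
    {c : Fin r → ℤ → Finset (Fin (4 * k))} (hc : IsMatchedCycleSystem (hypercube (4 * k)) (4 * k) c)
    (hN : N = 2 * (4 * k)) (hr : r' = r * (r * (2 * (2 * k)))) :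
    ∃ c' : Fin r' → ℤ → Finset (Fin N), IsMatchedCycleSystem (hypercube N) N c' := by
  obtain rfl : N = 4 * k + 4 * k := by omega
  obtain ⟨c', hc'⟩ := hc.boxProd hk
  have e : Fin r' ≃ Fin r × Fin r × Bool × Fin (2 * k) :=
    (Fintype.equivFinOfCardEq (by simp [hr])).symm
  have := hc'.map (hypercubeAddIso (4 * k) (4 * k)) e
  rw [two_mul (4 * k)] at this
  exact ⟨_, this⟩

theorem exists_matchedCycleSystem_hypercube (m : ℕ) (hm : 1 ≤ m) (N r : ℕ) (hN : N = 2 ^ m)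
    (hr : r = 2 ^ (N - 1 - m)) :
    ∃ c : Fin r → ℤ → Finset (Fin N), IsMatchedCycleSystem (hypercube N) N c := by
  obtain rfl | hm2 := hm.eq_or_lt
  · subst hN hr
    exact exists_matchedCycleSystem_hypercube_two
  clear hm
  induction m, hm2 using Nat.le_induction generalizing N r with
  | base =>
    subst hN hr
    exact exists_matchedCycleSystem_hypercube_four
  | succ m hm2 ih =>
    -- From `m = l + 2` the dimension gets the form `4 * k` with `k = 2 ^ l`.
    obtain ⟨l, rfl⟩ := Nat.exists_eq_add_of_le' hm2
    have h4 : 2 ^ (l + 2) = 4 * 2 ^ l := by ring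
    have hlt : l + 2 < 4 * 2 ^ l := h4 ▸ (l + 2).lt_two_pow_self
    obtain ⟨c, hc⟩ := ih (4 * 2 ^ l) _ h4.symm rfl
    have hN' : N = 2 * (4 * 2 ^ l) := by rw [hN]; ring
    refine hc.hypercube_double Nat.one_le_two_pow hN' ?_
    have e : N - 1 - (l + 2 + 1) = (4 * 2 ^ l - 1 - (l + 2)) + (4 * 2 ^ l - 1 - (l + 2)) +
        (l + 2) := by omega
    rw [hr, e, pow_add, pow_add]; ring

/-! ### Components of a disjoint union of paths -/

namespace SimpleGraph

/-- A disjoint union of `k` paths of length `l` has `k` components, each a path of length `l`. -/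
theorem components_of_disjoint_paths {W : Type*} {H : SimpleGraph W} {k l : ℕ}
    (f : Fin k × Fin (l + 1) ≃ W)
    (hf : ∀ p q, H.Adj (f p) (f q) ↔ p.1 = q.1 ∧ (pathGraph (l + 1)).Adj p.2 q.2) :
    Nat.card H.ConnectedComponent = k ∧
      ∀ K : H.ConnectedComponent, K.toSimpleGraph.IsPathOfLength l := by
  have hr : ∀ p q, H.Reachable (f p) (f q) ↔ p.1 = q.1 := by
    intro p q
    constructor
    · rintro ⟨w⟩
      have : ∀ u v (w : H.Walk u v), (f.symm u).1 = (f.symm v).1 := by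
        intro u v w
        induction w with
        | nil => rfl
        | @cons u v _ h _ ih =>
          rw [← ih]
          exact ((hf (f.symm u) (f.symm v)).1 (by simpa using h)).1
      simpa using this _ _ w
    · obtain ⟨t, s⟩ := p
      obtain ⟨t', s'⟩ := q
      rintro (rfl : t = t')
      let φ : pathGraph (l + 1) →g H := ⟨fun s => f (t, s), fun h => (hf _ _).2 ⟨rfl, h⟩⟩
      exact (pathGraph_preconnected (l + 1) s s').map φ
  have hmk : ∀ K : H.ConnectedComponent, ∃ t, K = H.connectedComponentMk (f (t, 0)) := by
    intro K
    induction K using ConnectedComponent.ind with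
    | h v =>
      obtain ⟨⟨t, s⟩, rfl⟩ := f.surjective v
      exact ⟨t, ConnectedComponent.eq.2 ((hr _ _).2 rfl)⟩
  constructor
  · rw [← Nat.card_fin k]
    refine (Nat.card_congr (Equiv.ofBijective
      (fun t => H.connectedComponentMk (f (t, 0))) ⟨fun t t' h => ?_, fun K => ?_⟩)).symm
    · exact (hr _ _).1 (ConnectedComponent.eq.1 h)
    · exact (hmk K).imp fun _ h => h.symm
  · intro K
    obtain ⟨t, rfl⟩ := hmk K
    have hmem : ∀ s, f (t, s) ∈ (H.connectedComponentMk (f (t, 0))).supp := fun s =>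
      ConnectedComponent.eq.2 ((hr _ _).2 rfl)
    let g : Fin (l + 1) → (H.connectedComponentMk (f (t, 0))).supp := fun s => ⟨f (t, s), hmem s⟩
    have hg : Function.Bijective g := by
      refine ⟨fun s s' h => ?_, fun ⟨v, hv⟩ => ?_⟩
      · simpa using f.injective (congrArg Subtype.val h)
      · obtain ⟨⟨t', s⟩, rfl⟩ := f.surjective v
        obtain rfl : t' = t := (hr _ _).1 (ConnectedComponent.eq.1 hv)
        exact ⟨s, rfl⟩
    exact ⟨(RelIso.mk (Equiv.ofBijective g hg) (by
      intro s s'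
      exact (hf (t, s) (t, s')).trans (by simp))).symm⟩

end SimpleGraph

/-! ### Cycles, paths and matching obtained from the walks -/

namespace IsMatchedCycleSystem

variable {V ι : Type*} {G : SimpleGraph V} {n : ℕ} {c : ι → ℤ → V}

theorem eq_of_bounds {N x y : ℤ} (h : N ∣ x - y) (h1 : x - y < N) (h2 : y - x < N) : x = y := by
  have := Int.eq_zero_of_abs_lt_dvd h (abs_lt.2 ⟨by linarith, h1⟩)
  linarith

theorem exists_bounded (hn : 0 < n) (hc : IsMatchedCycleSystem G n c) (i : ι) (x : ℤ) :
    ∃ y : Fin (n ^ 2), c i y = c i x ∧ c i (y + 1) = c i (x + 1) := by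
  have h0 : (0 : ℤ) < n ^ 2 := by positivity
  have h1 := Int.emod_nonneg x h0.ne'
  have h2 := Int.emod_lt_of_pos x h0
  have h3 := Int.mul_ediv_add_emod x (n ^ 2)
  refine ⟨⟨(x % n ^ 2).toNat, by zify; omega⟩, ?_, ?_⟩
  · refine hc.eq_of_sub_eq (-(x / n ^ 2)) ?_
    simp only [Int.toNat_of_nonneg h1]
    linear_combination h3
  · refine hc.eq_of_sub_eq (-(x / n ^ 2)) ?_
    simp only [Int.toNat_of_nonneg h1]
    linear_combination h3

/-- A surjection between finite sets of equal size is injective. -/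
theorem edge_unique [Finite V] [Fintype ι] (hn : 0 < n) (hc : IsMatchedCycleSystem G n c)
    (hcard : Fintype.card ι * n ^ 2 = Nat.card G.edgeSet) {i j : ι} {x y : ℤ}
    (h : s(c i x, c i (x + 1)) = s(c j y, c j (y + 1))) : i = j ∧ (n : ℤ) ^ 2 ∣ x - y := by
  let F : ι × Fin (n ^ 2) → G.edgeSet := fun p =>
    ⟨s(c p.1 p.2, c p.1 (p.2 + 1)), hc.adj _ _⟩
  have hF : Function.Surjective F := by
    rintro ⟨e, he⟩
    induction e with
    | h u v =>
      obtain ⟨i, x, hx⟩ := hc.edge u v he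
      obtain ⟨y, h1, h2⟩ := hc.exists_bounded hn i x
      refine ⟨(i, y), Subtype.ext ?_⟩
      simp only [F, h1, h2, hx]
  have hF' : Function.Injective F :=
    (hF.bijective_of_nat_card_le (by simp [← hcard])).1
  obtain ⟨x', h1, h2⟩ := hc.exists_bounded hn i x
  obtain ⟨y', h3, h4⟩ := hc.exists_bounded hn j y
  have := hF' (a₁ := (i, x')) (a₂ := (j, y')) (Subtype.ext (by simp only [F, h1, h2, h3, h4, h]))
  rw [Prod.mk.injEq] at this
  obtain ⟨rfl, rfl⟩ := this
  exact ⟨rfl, (hc.eq_iff i x y).1 (h1.symm.trans h3)⟩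

/-- The same counting, applied to the block ends of all walks. -/
theorem vertex_unique [Finite V] [Fintype ι] (hn : 0 < n) (hc : IsMatchedCycleSystem G n c)
    (hcard : Fintype.card ι * (n * 2) = Nat.card V) {i j : ι} {t t' : ℤ} {b b' : Bool}
    (h : c i (n * t + side n b) = c j (n * t' + side n b')) :
    i = j ∧ (n : ℤ) ∣ t - t' ∧ b = b' := by
  let F : ι × Fin n × Bool → V := fun p => c p.1 (n * p.2.1 + side n p.2.2)
  have hbd : ∀ i (t : ℤ) b, ∃ u : Fin n, (n : ℤ) ∣ t - u ∧ F (i, u, b) = c i (n * t + side n b) := by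
    intro i t b
    have h0 : (0 : ℤ) < n := by omega
    have h1 := Int.emod_nonneg t h0.ne'
    have h2 := Int.emod_lt_of_pos t h0
    have h3 := Int.mul_ediv_add_emod t n
    refine ⟨⟨(t % n).toNat, by omega⟩, ?_, ?_⟩
    · simp only [Int.toNat_of_nonneg h1]
      exact ⟨t / n, by linear_combination -h3⟩
    · refine hc.eq_of_sub_eq (-(t / n)) ?_
      simp only [Int.toNat_of_nonneg h1]
      linear_combination n * h3
  have hF : Function.Surjective F := by
    intro v
    obtain ⟨i, t, b, rfl⟩ := hc.exists_side v
    obtain ⟨u, -, hu⟩ := hbd i t b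
    exact ⟨_, hu⟩
  have hF' : Function.Injective F :=
    (hF.bijective_of_nat_card_le (by simp [← hcard])).1
  obtain ⟨u, h1, h2⟩ := hbd i t b
  obtain ⟨u', h3, h4⟩ := hbd j t' b'
  have := hF' (h2.trans (h.trans h4.symm))
  simp only [Prod.mk.injEq] at this
  obtain ⟨rfl, rfl, rfl⟩ := this
  exact ⟨rfl, by simpa using dvd_sub h1 h3, rfl⟩

/-- The cycle traced out by the closed walk `c i`. -/
def cycle (hc : IsMatchedCycleSystem G n c) (i : ι) : G.Subgraph where
  verts := Set.range (c i)
  Adj u v := ∃ x, s(u, v) = s(c i x, c i (x + 1))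
  adj_sub := by
    rintro u v ⟨x, hx⟩
    rw [← SimpleGraph.mem_edgeSet, hx]
    exact hc.adj i x
  edge_vert := by
    rintro u v ⟨x, hx⟩
    rcases Sym2.eq_iff.1 hx with ⟨rfl, -⟩ | ⟨rfl, -⟩ <;> exact ⟨_, rfl⟩
  symm := ⟨by
    rintro u v ⟨x, hx⟩
    exact ⟨x, Sym2.eq_swap.trans hx⟩⟩

theorem mem_edgeSet_cycle (hc : IsMatchedCycleSystem G n c) (i : ι) (e : Sym2 V) :
    e ∈ (hc.cycle i).edgeSet ↔ ∃ x, e = s(c i x, c i (x + 1)) := by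
  induction e with
  | h u v => rfl

theorem cycle_adj_iff (hc : IsMatchedCycleSystem G n c) (i : ι) (x y : ℤ) :
    (hc.cycle i).Adj (c i x) (c i y) ↔ (n : ℤ) ^ 2 ∣ x + 1 - y ∨ (n : ℤ) ^ 2 ∣ y + 1 - x := by
  constructor
  · rintro ⟨z, hz⟩
    simp only [Sym2.eq_iff, hc.eq_iff] at hz
    rcases hz with ⟨h1, h2⟩ | ⟨h1, h2⟩
    · left; rw [show x + 1 - y = x - z - (y - (z + 1)) by ring]; exact dvd_sub h1 h2
    · right; rw [show y + 1 - x = y - z - (x - (z + 1)) by ring]; exact dvd_sub h2 h1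
  · rintro (h | h)
    · exact ⟨x, by rw [(hc.eq_iff _ _ _).2 h]⟩
    · exact ⟨y, by rw [(hc.eq_iff _ _ _).2 h]; exact Sym2.eq_swap⟩

theorem cycle_isCycleOfLength (hc : IsMatchedCycleSystem G n c) (hn : 2 ≤ n) (i : ι) :
    (hc.cycle i).coe.IsCycleOfLength (n ^ 2) := by
  refine ⟨by nlinarith, ?_⟩
  have h4 : (4 : ℤ) ≤ n ^ 2 := by nlinarith
  let f : Fin (n ^ 2) → (hc.cycle i).verts := fun x => ⟨c i x, x, rfl⟩
  have hf : Function.Bijective f := by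
    refine ⟨fun x y h => ?_, ?_⟩
    · have h := (hc.eq_iff i x y).1 (congrArg Subtype.val h)
      have hx := x.2
      have hy := y.2
      zify at hx hy
      have := eq_of_bounds h (by omega) (by omega)
      exact Fin.ext (by exact_mod_cast this)
    · rintro ⟨_, x, rfl⟩
      obtain ⟨y, hy, -⟩ := hc.exists_bounded (by omega) i x
      exact ⟨y, Subtype.ext hy⟩
  -- `cycleGraph_adj'` expresses adjacency by the value of a difference in `Fin`; `1` is its own
  -- residue as `4 ≤ n ^ 2`.
  have hsub : ∀ x y : Fin (n ^ 2), (x - y).val = 1 ↔ (n : ℤ) ^ 2 ∣ y + 1 - x := by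
    intro x y
    have hx := x.2
    have hy := y.2
    rw [Fin.val_sub]
    have e : ((n ^ 2 - y.val + x.val : ℕ) : ℤ) = n ^ 2 + (x - y) := by
      rw [Nat.cast_add, Nat.cast_sub hy.le]; push_cast; ring
    rw [← Int.natCast_inj]
    push_cast [e]
    rw [show (n ^ 2 + (x - y) : ℤ) % n ^ 2 = (x - y) % n ^ 2 by simp]
    rw [show (y + 1 - x : ℤ) = 1 - (x - y) by ring, ← Int.modEq_iff_dvd, Int.ModEq,
      Int.emod_eq_of_lt (a := 1) (by omega) (by omega)]
  refine ⟨(RelIso.mk (Equiv.ofBijective f hf) ?_).symm⟩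
  intro x y
  rw [SimpleGraph.cycleGraph_adj', hsub, hsub, or_comm]
  exact hc.cycle_adj_iff i x y

/-- The matching edge at the end of block `t` of the walk `c i`. -/
def matchingEdge (n : ℕ) (c : ι → ℤ → V) (i : ι) (t : ℤ) : Sym2 V :=
  s(c i (n * t + (n - 1)), c i (n * t + (n - 1) + 1))

theorem matchingEdge_congr (hc : IsMatchedCycleSystem G n c) (i : ι) {t t' : ℤ}
    (h : (n : ℤ) ∣ t - t') : matchingEdge n c i t = matchingEdge n c i t' := by
  obtain ⟨q, hq⟩ := h
  rw [matchingEdge, matchingEdge, hc.eq_of_sub_eq (x := n * t + (n - 1)) (y := n * t' + (n - 1)) q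
    (by linear_combination n * hq), hc.eq_of_sub_eq (x := n * t + (n - 1) + 1)
    (y := n * t' + (n - 1) + 1) q (by linear_combination n * hq)]

theorem exists_fin_matchingEdge (hc : IsMatchedCycleSystem G n c) (hn : 0 < n) (i : ι) (t : ℤ) :
    ∃ j : Fin n, matchingEdge n c i t = matchingEdge n c i j := by
  have h1 := Int.emod_nonneg t (b := n) (by omega)
  have h2 := Int.emod_lt_of_pos t (b := n) (by omega)
  refine ⟨⟨(t % n).toNat, by omega⟩, hc.matchingEdge_congr i ?_⟩
  simp only [Int.toNat_of_nonneg h1]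
  exact Int.dvd_self_sub_emod

theorem matchingEdge_injective [Finite V] [Fintype ι] (hn : 0 < n)
    (hc : IsMatchedCycleSystem G n c) (hcard : Fintype.card ι * n ^ 2 = Nat.card G.edgeSet)
    (i : ι) : Function.Injective fun j : Fin n => matchingEdge n c i j := by
  intro j j' h
  obtain ⟨q, hq⟩ := (hc.edge_unique hn hcard h).2
  have h1 : (n : ℤ) ∣ j - j' := ⟨q, by
    have : (n : ℤ) ≠ 0 := by omega
    apply mul_left_cancel₀ this
    linear_combination hq⟩
  have := eq_of_bounds h1 (by omega) (by omega)
  exact Fin.ext (by exact_mod_cast this)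

theorem mem_range_matchingEdge [Finite V] [Fintype ι] (hn : 0 < n)
    (hc : IsMatchedCycleSystem G n c) (hcard : Fintype.card ι * n ^ 2 = Nat.card G.edgeSet)
    (i : ι) (x : ℤ) : s(c i x, c i (x + 1)) ∈ (Set.range fun j : Fin n => matchingEdge n c i j) ↔
      (n : ℤ) ∣ x + 1 := by
  constructor
  · rintro ⟨j, hj⟩
    obtain ⟨q, hq⟩ := (hc.edge_unique hn hcard hj).2
    exact ⟨j + 1 - n * q, by linear_combination -hq⟩
  · rintro ⟨q, hq⟩
    obtain ⟨j, hj⟩ := hc.exists_fin_matchingEdge hn i (q - 1)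
    refine ⟨j, hj.symm.trans ?_⟩
    rw [matchingEdge, show n * (q - 1) + (n - 1) = x by linear_combination -hq]

theorem mem_range_matchingEdge_block [Finite V] [Fintype ι]
    (hc : IsMatchedCycleSystem G n c) (hcard : Fintype.card ι * n ^ 2 = Nat.card G.edgeSet)
    (i : ι) {t s : ℤ} (hs : 0 ≤ s) (hs' : s < n) :
    s(c i (n * t + s), c i (n * t + s + 1)) ∈
      (Set.range fun j : Fin n => matchingEdge n c i j) ↔ s + 1 = n := by
  rw [hc.mem_range_matchingEdge (by omega) hcard, add_assoc,
    Int.dvd_add_right (Int.dvd_mul_right _ _)]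
  constructor
  · intro h
    have := Int.le_of_dvd (by omega) h
    omega
  · intro h
    rw [h]

theorem block_eq_of_dvd {t t' s s' : ℤ} {n : ℤ} (h : n ^ 2 ∣ n * t + s - (n * t' + s'))
    (ht : 0 ≤ t ∧ t < n) (ht' : 0 ≤ t' ∧ t' < n) (hs : 0 ≤ s ∧ s < n) (hs' : 0 ≤ s' ∧ s' < n) :
    t = t' ∧ s = s' := by
  have h1 : s = s' := by
    refine eq_of_bounds (N := n) ?_ (by linarith) (by linarith)
    have h2 : n ∣ n * t + s - (n * t' + s') := (Dvd.intro _ (sq n).symm).trans h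
    rw [show s - s' = n * t + s - (n * t' + s') - n * (t - t') by ring]
    exact dvd_sub h2 (Dvd.intro _ rfl)
  subst h1
  refine ⟨eq_of_bounds (N := n) ?_ (by linarith) (by linarith), rfl⟩
  rw [show n * t + s - (n * t' + s) = n * (t - t') by ring, sq] at h
  exact Int.dvd_of_mul_dvd_mul_left (by linarith) h

/-- The deleted edges are exactly those leaving a block, so `(t, s) ↦ n * t + s` exhibits the rest
as `n` disjoint paths. -/
theorem components_cycle_deleteEdges [Finite V] [Fintype ι] (hn : 2 ≤ n)
    (hc : IsMatchedCycleSystem G n c) (hcard : Fintype.card ι * n ^ 2 = Nat.card G.edgeSet)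
    (i : ι) (H : G.Subgraph)
    (hH : H = (hc.cycle i).deleteEdges (Set.range fun j : Fin n => matchingEdge n c i j)) :
    Nat.card H.coe.ConnectedComponent = n ∧
      ∀ K : H.coe.ConnectedComponent, K.toSimpleGraph.IsPathOfLength (n - 1) := by
  obtain ⟨l, hl⟩ := Nat.exists_eq_add_of_le' (show 1 ≤ n by omega)
  rw [show n - 1 = l by omega]
  subst hH
  let f : Fin n × Fin (l + 1) → ((hc.cycle i).deleteEdges
    (Set.range fun j : Fin n => matchingEdge n c i j)).verts :=
    fun p => ⟨c i (n * p.1 + p.2), _, rfl⟩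
  have hf : Function.Bijective f := by
    refine ⟨?_, ?_⟩
    · rintro ⟨t, s⟩ ⟨t', s'⟩ h
      have := block_eq_of_dvd ((hc.eq_iff i _ _).1 (congrArg Subtype.val h))
        (by constructor <;> omega) (by constructor <;> omega) (by constructor <;> omega)
        (by constructor <;> omega)
      exact Prod.ext (Fin.ext (by exact_mod_cast this.1)) (Fin.ext (by exact_mod_cast this.2))
    · rintro ⟨_, x, rfl⟩
      obtain ⟨⟨y, hy⟩, hyx, -⟩ := hc.exists_bounded (by omega) i x
      refine ⟨(⟨y / n, Nat.div_lt_of_lt_mul (by rwa [← sq])⟩,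
        ⟨y % n, hl ▸ Nat.mod_lt _ (by omega)⟩), Subtype.ext ?_⟩
      refine Eq.trans ?_ hyx
      have := Nat.div_add_mod y n
      simp only [f]
      congr 1
      exact_mod_cast this
  have key : ∀ (t t' : Fin n) (s s' : Fin (l + 1)),
      ((n : ℤ) ^ 2 ∣ n * t + s + 1 - (n * t' + s') ∧
        s(c i (n * t + s), c i (n * t' + s')) ∉
          Set.range fun j : Fin n => matchingEdge n c i j) ↔ t = t' ∧ s.val + 1 = s'.val := by
    intro t t' s s'
    have hmem := hc.mem_range_matchingEdge_block hcard i (t := t) (s := s) (by omega) (by omega)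
    constructor
    · rintro ⟨h1, h2⟩
      rw [← (hc.eq_iff i _ _).2 h1, hmem] at h2
      rw [add_assoc] at h1
      have := block_eq_of_dvd h1 (by constructor <;> omega) (by constructor <;> omega)
        (by constructor <;> omega) (by constructor <;> omega)
      exact ⟨Fin.ext (by exact_mod_cast this.1), by exact_mod_cast this.2⟩
    · rintro ⟨rfl, h⟩
      have h1 : (n * t + s' : ℤ) = n * t + s + 1 := by omega
      rw [h1, hmem]
      exact ⟨by simp, by omega⟩
  refine SimpleGraph.components_of_disjoint_paths (Equiv.ofBijective f hf) ?_
  rintro ⟨t, s⟩ ⟨t', s'⟩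
  simp only [Equiv.ofBijective_apply, SimpleGraph.Subgraph.coe_adj,
    SimpleGraph.Subgraph.deleteEdges_adj, f, SimpleGraph.pathGraph_adj]
  -- The two disjuncts are the two orientations of an edge; the second is `key` with the endpoints
  -- exchanged.
  rw [hc.cycle_adj_iff, or_and_right, key, Sym2.eq_swap, key, eq_comm (a := t'), and_or_left]

/-- By `vertex_unique` a vertex is an end or a start of a block, never both, and of only one block
up to the period; its partner is across the adjacent block boundary. -/
theorem matching_isPerfectMatching [Finite V] [Fintype ι] (hn : 2 ≤ n)
    (hc : IsMatchedCycleSystem G n c) (hcard : Fintype.card ι * (n * 2) = Nat.card V) :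
    ∃ M : G.Subgraph, M.IsPerfectMatching ∧
      M.edgeSet = {x | ∃ (i : ι) (j : Fin n), x = matchingEdge n c i j} := by
  let M : G.Subgraph :=
    { verts := Set.univ
      Adj u v := ∃ (i : ι) (t : ℤ), s(u, v) = matchingEdge n c i t
      adj_sub := by
        rintro u v ⟨i, t, h⟩
        rw [← SimpleGraph.mem_edgeSet, h]
        exact hc.adj _ _
      edge_vert := fun _ => trivial
      symm := ⟨by
        rintro u v ⟨i, t, h⟩
        exact ⟨i, t, Sym2.eq_swap.trans h⟩⟩ }
  refine ⟨M, ⟨?_, fun _ => trivial⟩, ?_⟩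
  · have hme : ∀ i t, matchingEdge n c i t =
        s(c i (n * t + side n true), c i (n * (t + 1) + side n false)) := by
      intro i t
      have : n * t + (n - 1) + 1 = (n * (t + 1) + 0 : ℤ) := by ring
      simp only [matchingEdge, side, this]
      simp
    rintro v -
    obtain ⟨i, t, b, rfl⟩ := hc.exists_side v
    cases b with
    | true =>
      refine ⟨c i (n * (t + 1) + side n false), ⟨i, t, (hme i t).symm⟩, ?_⟩
      rintro w ⟨j, t', h⟩
      rw [hme, Sym2.eq_iff] at h
      rcases h with ⟨h, rfl⟩ | ⟨h, rfl⟩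
      · obtain ⟨rfl, ⟨q, hq⟩, -⟩ := hc.vertex_unique (by omega) hcard h
        exact hc.eq_of_sub_eq (-q) (by linear_combination -n * hq)
      · exact absurd (hc.vertex_unique (by omega) hcard h).2.2 (by simp)
    | false =>
      refine ⟨c i (n * (t - 1) + side n true), ⟨i, t - 1, ?_⟩, ?_⟩
      · rw [hme, sub_add_cancel, Sym2.eq_swap]
      rintro w ⟨j, t', h⟩
      rw [hme, Sym2.eq_iff] at h
      rcases h with ⟨h, rfl⟩ | ⟨h, rfl⟩
      · exact absurd (hc.vertex_unique (by omega) hcard h).2.2 (by simp)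
      · obtain ⟨rfl, ⟨q, hq⟩, -⟩ := hc.vertex_unique (by omega) hcard h
        exact hc.eq_of_sub_eq (-q) (by linear_combination -n * hq)
  · ext e
    induction e with
    | h u v =>
      constructor
      · rintro ⟨i, t, h⟩
        obtain ⟨j, hj⟩ := hc.exists_fin_matchingEdge (by omega) i t
        exact ⟨i, j, h.trans hj⟩
      · rintro ⟨i, j, h⟩
        exact ⟨i, j, h⟩

end IsMatchedCycleSystem

/-! ### Edge count of the hypercube and the theorem -/

theorem card_edgeSet_hypercube (n : ℕ) : 2 * Nat.card (hypercube n).edgeSet = 2 ^ n * n := by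
  classical
  have hdeg : ∀ A, (hypercube n).degree A = n := by
    intro A
    rw [← SimpleGraph.card_neighborSet_eq_degree]
    have : Function.Bijective fun d : Fin n => (⟨symmDiff A {d}, by
        simp [SimpleGraph.mem_neighborSet, hypercube]⟩ : (hypercube n).neighborSet A) := by
      refine ⟨fun d d' h => ?_, ?_⟩
      · simpa using congrArg Subtype.val h
      · rintro ⟨B, hB⟩
        obtain ⟨d, hd⟩ := Finset.card_eq_one.1 hB
        exact ⟨d, Subtype.ext (by simp [← hd])⟩
    rw [← Fintype.card_of_bijective this, Fintype.card_fin]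
  have := (hypercube n).sum_degrees_eq_twice_card_edges
  simp only [hdeg, Finset.sum_const, Finset.card_univ, Fintype.card_finset, Fintype.card_fin,
    smul_eq_mul] at this
  rw [this, Nat.card_eq_fintype_card, ← SimpleGraph.edgeFinset_card]

theorem theorem3p1 (m n : ℕ) (hm : 1 ≤ m) (hn : n = 2 ^ m) :
    ∃ (C : Fin (2 ^ (n - 1 - m)) → (hypercube n).Subgraph)
      (e : Fin (2 ^ (n - 1 - m)) → Fin (2 ^ m) → Sym2 (Finset (Fin n))),
      -- the `C i` are cycles of length `2 ^ m * n` that decompose the hypercube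
      (hypercube n).IsDecomposition C ∧
      (∀ i, (C i).coe.IsCycleOfLength (2 ^ m * n)) ∧
      -- (I) `e i` lists `2 ^ m` distinct edges of `C i`, and deleting them leaves exactly `2 ^ m`
      -- components, each of them a path of length `n - 1`
      (∀ i, Function.Injective (e i) ∧ (∀ j, e i j ∈ (C i).edgeSet) ∧
        Nat.card ((C i).deleteEdges (Set.range (e i))).coe.ConnectedComponent = 2 ^ m ∧
        ∀ K : ((C i).deleteEdges (Set.range (e i))).coe.ConnectedComponent,
          K.toSimpleGraph.IsPathOfLength (n - 1)) ∧
      -- (II) all the chosen edges together form a perfect matching of the hypercube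
      (∃ M : (hypercube n).Subgraph, M.IsPerfectMatching ∧
        M.edgeSet = {x | ∃ i j, x = e i j}) := by
  obtain ⟨c, hc⟩ := exists_matchedCycleSystem_hypercube m hm n _ hn rfl
  -- This keeps the subtraction in the exponent `n - 1 - m` from truncating.
  have hmn : m < n := hn ▸ m.lt_two_pow_self
  have hn2 : 2 ≤ n := by omega
  have hV : 2 ^ (n - 1 - m) * (n * 2) = 2 ^ n := by
    conv_lhs => rw [hn]
    rw [← pow_succ, ← pow_add]
    congr 1
    omega
  have hV' : Fintype.card (Fin (2 ^ (n - 1 - m))) * (n * 2) = Nat.card (Finset (Fin n)) := by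
    simpa using hV
  have hE' : Fintype.card (Fin (2 ^ (n - 1 - m))) * n ^ 2 = Nat.card (hypercube n).edgeSet := by
    have := card_edgeSet_hypercube n
    rw [← hV] at this
    rw [Fintype.card_fin]
    nlinarith
  rw [← hn]
  refine ⟨hc.cycle, fun i j => IsMatchedCycleSystem.matchingEdge n c i j, ⟨?_, ?_⟩, fun i => ?_,
    fun i => ⟨hc.matchingEdge_injective (by omega) hE' i, fun j => ⟨_, rfl⟩,
      hc.components_cycle_deleteEdges hn2 hE' i _ rfl⟩, hc.matching_isPerfectMatching hn2 hV'⟩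
  · intro i j hij
    rw [Set.disjoint_left]
    intro e h1 h2
    obtain ⟨x, rfl⟩ := (hc.mem_edgeSet_cycle i _).1 h1
    obtain ⟨y, hy⟩ := (hc.mem_edgeSet_cycle j _).1 h2
    exact hij (hc.edge_unique (by omega) hE' hy).1
  · ext e
    simp only [Set.mem_iUnion]
    constructor
    · rintro ⟨i, h⟩
      exact (hc.cycle i).edgeSet_subset h
    · intro h
      induction e with
      | h u v => exact hc.edge u v h
  · rw [← sq]
    exact hc.cycle_isCycleOfLength hn2 i
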